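/- Let $\Omega\subset\mathbb C^n$ be a bounded domain (non-empty, open, connected) with $\mathcal C^2$-smooth boundary, i.e. every $p\in\partial\Omega$ has an open neighbourhood $U$ with a $\mathcal C^2$ function $\rho:U\to\mathbb R$, $d\rho\neq0$ on $U$, such that $\Omega\cap U=\{z\in U:\rho(z)<0\}$. Let $\Delta$ be the unit disc in $\mathbb C$. The Kobayashi pseudodistance $k_\Omega$ is the largest pseudodistance on $\Omega$ that does not exceed the Lempert function $$l_\Omega(z,w)=\inf\{\tanh^{-1}|\alpha| : \alpha\in\Delta,\ \exists\,\varphi\in\mathcal O(\Delta,\Omega),\ \varphi(0)=z,\ \varphi(\alpha)=w\},$$ the Kobayashi--Royden pseudometric is $$\kappa_\Omega(z;v)=\inf\{|\alpha| : \alpha\in\mathbb C,\ \exists\,\varphi\in\mathcal O(\Delta,\Omega),\ \varphi(0)=z,\ \alpha\varphi'(0)=v\},$$ and the length of an absolutely continuous curve $\gamma:[a,b]\to\Omega$ is $l^\kappa_\Omega(\gamma)=\int_a^b\kappa_\Omega(\gamma(t);\gamma'(t))\,dt$. For $\lambda\ge1$ and $\epsilon\ge0$, an absolutely continuous curve $\gamma:[0,l]\to\Omega$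 is a $(\lambda,\epsilon)$-geodesic if $$l^\kappa_\Omega(\gamma|_{[t_1,t_2]})\le\lambda\,k_\Omega(\gamma(t_1),\gamma(t_2))+\epsilon\qquad\text{for all }0\le t_1\le t_2\le l.$$ $\Omega$ has the $(\lambda,\epsilon)$-visibility property if for all distinct $p,q\in\partial\Omega$ there are neighbourhoods $U$ of $p$ and $V$ of $q$ and a compact set $K\subset\Omega$ such that every $(\lambda,\epsilon)$-geodesic $\gamma:[0,l]\to\Omega$ with $\gamma(0)\in\Omega\cap U$ and $\gamma(l)\in\Omega\cap V$ satisfies $\gamma([0,l])\cap K\neq\emptyset$. Suppose that either 1. $\Omega$ has the $(1,\epsilon)$-visibility property for some $\epsilon>0$; or 2. $\Omega$ has the $(\lambda,0)$-visibility property for every $\lambda>1$. Then $\Omega$ is pseudoconvex, i.e. there is a continuous plurisubharmonic function $u:\Omega\to\mathbb R$ such that $\{z\in\Omega:u(z)\le c\}$ is compact for every $c\in\mathbb R$. -/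

import Mathlib

open Set Metric MeasureTheory
open scoped ENNReal NNReal

noncomputable section

/-- Complex Euclidean space `ℂⁿ` with its Hermitian norm. -/
abbrev Cn (n : ℕ) : Type := EuclideanSpace ℂ (Fin n)

/-- `φ` restricts to a holomorphic map from the open unit disc of `ℂ` into `Ω`. -/
def IsHolomorphicDisc {n : ℕ} (Ω : Set (Cn n)) (φ : ℂ → Cn n) : Prop :=
  DifferentiableOn ℂ φ (ball 0 1) ∧ MapsTo φ (ball 0 1) Ω

/-- The Lempert function of `Ω`: the infimum of `artanh |α|` over all holomorphic discs `φ` in `Ω`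
and all `α` in the unit disc with `φ 0 = z`, `φ α = w` (it is `∞` if there are none). -/
def lempertFunction {n : ℕ} (Ω : Set (Cn n)) (z w : Cn n) : ℝ≥0∞ :=
  ⨅ (φ : ℂ → Cn n) (α : ℂ) (_ : IsHolomorphicDisc Ω φ ∧ α ∈ ball (0 : ℂ) 1 ∧ φ 0 = z ∧ φ α = w),
    ENNReal.ofReal (Real.artanh ‖α‖)

/-- `d` restricts to a (finite, nonnegative) pseudodistance on `Ω`. -/
structure IsPseudodistanceOn {n : ℕ} (Ω : Set (Cn n)) (d : Cn n → Cn n → ℝ≥0) : Prop where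
  self : ∀ x ∈ Ω, d x x = 0
  symm : ∀ x ∈ Ω, ∀ y ∈ Ω, d x y = d y x
  triangle : ∀ x ∈ Ω, ∀ y ∈ Ω, ∀ z ∈ Ω, d x z ≤ d x y + d y z

/-- The Kobayashi pseudodistance of `Ω`: the largest pseudodistance on `Ω` that does not exceed
the Lempert function, obtained as the pointwise supremum of all such pseudodistances. -/
def kobayashiDist {n : ℕ} (Ω : Set (Cn n)) (z w : Cn n) : ℝ≥0∞ :=
  ⨆ (d : Cn n → Cn n → ℝ≥0)
    (_ : IsPseudodistanceOn Ω d ∧ ∀ x ∈ Ω, ∀ y ∈ Ω, (d x y : ℝ≥0∞) ≤ lempertFunction Ω x y),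
    (d z w : ℝ≥0∞)

/-- The Kobayashi-Royden pseudometric of `Ω` at the point `z` in the direction `v`. -/
def kobayashiRoyden {n : ℕ} (Ω : Set (Cn n)) (z v : Cn n) : ℝ≥0∞ :=
  ⨅ (φ : ℂ → Cn n) (α : ℂ) (_ : IsHolomorphicDisc Ω φ ∧ φ 0 = z ∧ α • deriv φ 0 = v), ‖α‖ₑ

/-- The Kobayashi-Royden length of the restriction of the curve `γ` to `[a, b]`. -/
def kobayashiLength {n : ℕ} (Ω : Set (Cn n)) (γ : ℝ → Cn n) (a b : ℝ) : ℝ≥0∞ :=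
  ∫⁻ t in Icc a b, kobayashiRoyden Ω (γ t) (deriv γ t)

/-- The restriction of `γ` to `[0, l]` is a `(lam, ε)`-geodesic of `Ω`: an absolutely continuous
curve in `Ω` each of whose arcs has length at most `lam` times the Kobayashi distance of its
endpoints plus `ε`. -/
structure IsAlmostGeodesic {n : ℕ} (Ω : Set (Cn n)) (lam ε l : ℝ) (γ : ℝ → Cn n) : Prop where
  nonneg : 0 ≤ l
  mapsTo : MapsTo γ (Icc 0 l) Ω
  absolutelyContinuous : AbsolutelyContinuousOnInterval γ 0 l
  length_le : ∀ t₁ t₂ : ℝ, 0 ≤ t₁ → t₁ ≤ t₂ → t₂ ≤ l →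
    kobayashiLength Ω γ t₁ t₂ ≤
      ENNReal.ofReal lam * kobayashiDist Ω (γ t₁) (γ t₂) + ENNReal.ofReal ε

/-- The `(lam, ε)`-visibility property (for `1 ≤ lam` and `0 ≤ ε`). -/
def HasVisibility {n : ℕ} (Ω : Set (Cn n)) (lam ε : ℝ) : Prop :=
  ∀ p ∈ frontier Ω, ∀ q ∈ frontier Ω, p ≠ q →
    ∃ U ∈ nhds p, ∃ V ∈ nhds q, ∃ K : Set (Cn n), IsCompact K ∧ K ⊆ Ω ∧
      ∀ (l : ℝ) (γ : ℝ → Cn n), IsAlmostGeodesic Ω lam ε l γ →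
        γ 0 ∈ Ω ∩ U → γ l ∈ Ω ∩ V → (γ '' Icc 0 l ∩ K).Nonempty

/-- `Ω` has `C²`-smooth boundary: near each boundary point it is the negativity set of a
real-valued `C²` function without critical points. -/
def HasC2Boundary {n : ℕ} (Ω : Set (Cn n)) : Prop :=
  ∀ p ∈ frontier Ω, ∃ (U : Set (Cn n)) (ρ : Cn n → ℝ), IsOpen U ∧ p ∈ U ∧
    ContDiffOn ℝ 2 ρ U ∧ (∀ z ∈ U, fderiv ℝ ρ z ≠ 0) ∧ Ω ∩ U = {z ∈ U | ρ z < 0}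

/-- The continuous function `u` is plurisubharmonic on the open set `Ω`: it satisfies the
sub-mean value inequality on every closed affine complex disc contained in `Ω`. -/
def IsContinuousPsh {n : ℕ} (Ω : Set (Cn n)) (u : Cn n → ℝ) : Prop :=
  ContinuousOn u Ω ∧
    ∀ z w : Cn n, (∀ ζ ∈ closedBall (0 : ℂ) 1, z + ζ • w ∈ Ω) →
      u z ≤ Real.circleAverage (fun ζ : ℂ => u (z + ζ • w)) 0 1

/-- `Ω` is pseudoconvex: it has a continuous plurisubharmonic exhaustion function. -/
def IsPseudoconvex {n : ℕ} (Ω : Set (Cn n)) : Prop :=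
  ∃ u : Cn n → ℝ, IsContinuousPsh Ω u ∧ ∀ c : ℝ, IsCompact {z ∈ Ω | u z ≤ c}

end

/-!
If `Ω` is not pseudoconvex, then `-log δ`, with `δ` the distance to the complement, violates the
sub-mean value inequality on some affine disc. Correcting that disc by the exponential of an
entire function yields a holomorphic disc `ψ` with `ψ 0` on the boundary and
`δ (ψ σ) ≥ c ‖σ‖ ^ 2`: the boundary is strictly pseudoconcave in the complex tangent direction
`deriv ψ 0`. Since the boundary is `C²`, some curve on it has complex tangent velocities and starts
in that direction, and a perturbation of `ψ` through each of its points, pushed slightly inwards,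
stays in `Ω` on a disc of fixed radius. So the Kobayashi-Royden speed of the pushed curves is
bounded independently of their distance to the boundary. Short pieces of them are therefore almost
geodesics, which contradicts visibility because they leave every compact subset of `Ω`.
-/

open Filter Topology

/-! ### Failure of the sub-mean value inequality -/

lemma exists_entire_re_eq_of_mem_span_fourier {g : C(AddCircle (1 : ℝ), ℂ)}
    (hg : g ∈ Submodule.span ℂ (range (@fourier (1 : ℝ)))) :
    ∃ P : ℂ → ℂ, Differentiable ℂ P ∧ ∀ x, (g x).re = (P (AddCircle.toCircle x)).re := by
  -- Multiplication by an arbitrary constant keeps the claim stable under scalar multiplication.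
  suffices h : ∀ c : ℂ, ∃ P : ℂ → ℂ, Differentiable ℂ P ∧
      ∀ x, (c * g x).re = (P (AddCircle.toCircle x)).re by simpa using h 1
  induction hg using Submodule.span_induction with
  | mem g hg =>
    obtain ⟨k, rfl⟩ := hg
    intro c
    obtain ⟨m, rfl | rfl⟩ := k.eq_nat_or_neg
    · exact ⟨fun z => c * z ^ m, by fun_prop, fun x => by
        simp [fourier_apply, AddCircle.toCircle_nsmul]⟩
    -- On the circle `c * z⁻¹ ^ m` is the conjugate of `conj c * z ^ m`.
    · refine ⟨fun z => (starRingEnd ℂ) c * z ^ m, by fun_prop, fun x => ?_⟩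
      rw [← Complex.conj_re]
      simp only [fourier_apply, neg_smul, natCast_zsmul, AddCircle.toCircle_neg,
        AddCircle.toCircle_nsmul, Circle.coe_inv_eq_conj, Circle.coe_pow, map_mul, map_pow,
        Complex.conj_conj]
  | zero => exact fun c => ⟨0, differentiable_const 0, by simp⟩
  | add g₁ g₂ _ _ h₁ h₂ =>
    intro c
    obtain ⟨P₁, hP₁, e₁⟩ := h₁ c
    obtain ⟨P₂, hP₂, e₂⟩ := h₂ c
    exact ⟨P₁ + P₂, hP₁.add hP₂, fun x => by
      simp only [ContinuousMap.add_apply, mul_add, Complex.add_re, e₁, e₂, Pi.add_apply]⟩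
  | smul a g _ h =>
    intro c
    obtain ⟨P, hP, e⟩ := h (c * a)
    exact ⟨P, hP, fun x => by simpa [mul_assoc] using e x⟩

lemma exists_entire_abs_sub_re_lt_on_sphere {f : ℂ → ℝ} (hf : ContinuousOn f (sphere 0 1)) {ε : ℝ}
    (hε : 0 < ε) :
    ∃ P : ℂ → ℂ, Differentiable ℂ P ∧ ∀ z ∈ sphere (0 : ℂ) 1, |f z - (P z).re| < ε := by
  let g : C(AddCircle (1 : ℝ), ℂ) := ⟨fun x => (f (AddCircle.toCircle x) : ℂ),
    Complex.continuous_ofReal.comp (hf.comp_continuous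
      (continuous_subtype_val.comp AddCircle.continuous_toCircle)
      fun x => mem_sphere_zero_iff_norm.2 (Circle.norm_coe _))⟩
  have hg : g ∈ (Submodule.span ℂ (range (@fourier (1 : ℝ)))).topologicalClosure := by
    rw [span_fourier_closure_eq_top]
    trivial
  obtain ⟨q, hq, hgq⟩ := Metric.mem_closure_iff.1 hg ε hε
  obtain ⟨P, hP, hqP⟩ := exists_entire_re_eq_of_mem_span_fourier hq
  refine ⟨P, hP, fun z hz => ?_⟩
  obtain ⟨x, hx⟩ := (AddCircle.homeomorphCircle (T := (1 : ℝ)) one_ne_zero).surjective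
    ⟨z, by simpa [Submonoid.unitSphere] using hz⟩
  have hxz : ((AddCircle.toCircle x : Circle) : ℂ) = z := by
    rw [← AddCircle.homeomorphCircle_apply one_ne_zero, hx]
  calc |f z - (P z).re| = |(g x - q x).re| := by rw [← hxz, ← hqP x]; simp [g]
    _ ≤ ‖g x - q x‖ := Complex.abs_re_le_norm _
    _ = dist (g x) (q x) := (dist_eq_norm _ _).symm
    _ < ε := (ContinuousMap.dist_apply_le_dist x).trans_lt hgq

lemma exists_entire_lt_re_on_sphere_of_circleAverage_lt {f : ℂ → ℝ}
    (hf : ContinuousOn f (sphere 0 1)) {y : ℝ} (h : Real.circleAverage f 0 1 < y) :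
    ∃ P : ℂ → ℂ, Differentiable ℂ P ∧ (∀ z ∈ sphere (0 : ℂ) 1, f z < (P z).re) ∧ (P 0).re < y := by
  obtain ⟨ε, hε, hεy⟩ : ∃ ε > 0, Real.circleAverage f 0 1 + 2 * ε < y :=
    ⟨(y - Real.circleAverage f 0 1) / 3, by linarith, by linarith⟩
  obtain ⟨P, hP, hfP⟩ := exists_entire_abs_sub_re_lt_on_sphere hf hε
  have hre : Continuous fun z => (P z).re := Complex.continuous_re.comp hP.continuous
  have hmean : Real.circleAverage (fun z => (P z).re) 0 1 = (P 0).re :=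
    InnerProductSpace.HarmonicOnNhd.circleAverage_eq fun z _ => (hP.analyticAt z).harmonicAt_re
  have hP0 : (P 0).re ≤ Real.circleAverage f 0 1 + ε := by
    have hfi : CircleIntegrable f 0 1 := ContinuousOn.circleIntegrable' (by simpa using hf)
    have hci : CircleIntegrable (fun _ => ε) (0 : ℂ) 1 := circleIntegrable_const _ _ _
    calc (P 0).re = Real.circleAverage (fun z => (P z).re) 0 1 := hmean.symm
      _ ≤ Real.circleAverage (fun z => f z + ε) 0 1 :=
          Real.circleAverage_mono hre.continuousOn.circleIntegrable' (hfi.add hci) fun z hz => by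
            linarith [(abs_lt.1 (hfP z (by simpa using hz))).1]
      _ = Real.circleAverage f 0 1 + ε := by
          rw [Real.circleAverage_fun_add hfi hci, Real.circleAverage_const]
  refine ⟨fun z => P z + ε, hP.add_const _, fun z hz => ?_, ?_⟩
  · simp only [Complex.add_re, Complex.ofReal_re]
    linarith [(abs_lt.1 (hfP z hz)).2]
  · simp only [Complex.add_re, Complex.ofReal_re]
    linarith

lemma exists_touching_of_circleAverage_lt {f : ℂ → ℝ} (hf : ContinuousOn f (closedBall 0 1))
    (h : Real.circleAverage f 0 1 < f 0) :
    ∃ τ ∈ ball (0 : ℂ) 1, ∃ c > 0, ∃ F : ℂ → ℂ, Differentiable ℂ F ∧ F 0 = 0 ∧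
      ∀ᶠ σ in 𝓝 (0 : ℂ), f (τ + σ) ≤ f τ + (F σ).re - c * ‖σ‖ ^ 2 := by
  obtain ⟨P, hP, hfP, hP0⟩ :=
    exists_entire_lt_re_on_sphere_of_circleAverage_lt (hf.mono sphere_subset_closedBall) h
  set c := f 0 - (P 0).re
  -- At `0` this function equals `c`, while on the unit circle it is smaller than `c`.
  set g : ℂ → ℝ := fun z => f z - (P z).re + c * ‖z‖ ^ 2 with hg
  have hgc : ContinuousOn g (closedBall 0 1) := by
    have := hP.continuous
    fun_prop
  obtain ⟨τ, hτ, hmax⟩ := (isCompact_closedBall (0 : ℂ) 1).exists_isMaxOn ⟨0, by simp⟩ hgc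
  have hτ1 : τ ∈ ball (0 : ℂ) 1 := by
    by_contra hn
    have hτ1 : ‖τ‖ = 1 := le_antisymm (by simpa using hτ) (by simpa using hn)
    have hlt : f τ < (P τ).re := hfP τ (by simpa using hτ1)
    have hle : g 0 ≤ g τ := hmax (by simp)
    simp only [hg, hτ1, norm_zero] at hle
    linarith
  refine ⟨τ, hτ1, c, sub_pos.2 hP0,
    fun σ => P (τ + σ) - P τ - (2 * c : ℝ) * ((starRingEnd ℂ τ) * σ), by fun_prop, by simp, ?_⟩
  have hev : ∀ᶠ σ in 𝓝 (0 : ℂ), τ + σ ∈ ball (0 : ℂ) 1 :=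
    (continuous_const_add τ).tendsto' 0 τ (add_zero τ) (isOpen_ball.mem_nhds hτ1)
  filter_upwards [hev] with σ hσ
  have hle : g (τ + σ) ≤ g τ := hmax (ball_subset_closedBall hσ)
  have hsq : ‖τ + σ‖ ^ 2 = ‖τ‖ ^ 2 + 2 * ((starRingEnd ℂ τ) * σ).re + ‖σ‖ ^ 2 := by
    simp only [← Complex.normSq_eq_norm_sq, Complex.normSq_apply, Complex.add_re, Complex.add_im,
      Complex.mul_re, Complex.conj_re, Complex.conj_im]
    ring
  simp only [hg, hsq] at hle
  rw [Complex.sub_re, Complex.sub_re, Complex.re_ofReal_mul]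
  linarith

/-- The function `-log δ_Ω`, where `δ_Ω` is the distance to the complement of `Ω`. A bounded open
set on which it satisfies the sub-mean value inequality is pseudoconvex. -/
noncomputable def negLogDistCompl {X : Type*} [PseudoMetricSpace X] (Ω : Set X) (z : X) : ℝ :=
  -Real.log (infDist z Ωᶜ)

lemma mem_iff_infDist_compl_pos {X : Type*} [PseudoMetricSpace X] {Ω : Set X} (hΩ : IsOpen Ω)
    (hne : Ω ≠ univ) {x : X} : x ∈ Ω ↔ 0 < infDist x Ωᶜ := by
  rw [← hΩ.isClosed_compl.notMem_iff_infDist_pos (nonempty_compl.2 hne), notMem_compl_iff]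

lemma continuousOn_negLogDistCompl {X : Type*} [PseudoMetricSpace X] {Ω : Set X} (hΩ : IsOpen Ω)
    (hne : Ω ≠ univ) : ContinuousOn (negLogDistCompl Ω) Ω :=
  ((continuous_infDist_pt _).continuousOn.log fun _ hx =>
    ((mem_iff_infDist_compl_pos hΩ hne).1 hx).ne').neg

lemma isCompact_sublevel_negLogDistCompl {X : Type*} [PseudoMetricSpace X] [ProperSpace X]
    {Ω : Set X} (hΩ : IsOpen Ω) (hne : Ω ≠ univ) (hbdd : Bornology.IsBounded Ω) (c : ℝ) :
    IsCompact {z ∈ Ω | negLogDistCompl Ω z ≤ c} := by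
  have heq : {z ∈ Ω | negLogDistCompl Ω z ≤ c} = {z | Real.exp (-c) ≤ infDist z Ωᶜ} := by
    ext z
    simp only [mem_ofPred_eq, mem_iff_infDist_compl_pos hΩ hne, negLogDistCompl, neg_le]
    exact ⟨fun h => (Real.le_log_iff_exp_le h.1).1 h.2, fun h =>
      have hpos := (Real.exp_pos (-c)).trans_le h
      ⟨hpos, (Real.le_log_iff_exp_le hpos).2 h⟩⟩
  refine isCompact_of_isClosed_isBounded ?_ (hbdd.subset (sep_subset _ _))
  rw [heq]
  exact isClosed_le continuous_const (continuous_infDist_pt _)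

lemma isPseudoconvex_of_le_circleAverage {n : ℕ} {Ω : Set (Cn n)} (hΩ : IsOpen Ω)
    (hne : Ω ≠ univ) (hbdd : Bornology.IsBounded Ω)
    (h : ∀ z w : Cn n, (∀ ζ ∈ closedBall (0 : ℂ) 1, z + ζ • w ∈ Ω) → negLogDistCompl Ω z ≤
      Real.circleAverage (fun ζ : ℂ => negLogDistCompl Ω (z + ζ • w)) 0 1) :
    IsPseudoconvex Ω :=
  ⟨negLogDistCompl Ω, ⟨continuousOn_negLogDistCompl hΩ hne, h⟩,
    isCompact_sublevel_negLogDistCompl hΩ hne hbdd⟩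

/-- An entire disc `ψ` centred at a boundary point of `Ω` which penetrates `Ω` so deeply that its
distance to the complement grows at least quadratically. Pseudoconvexity excludes such discs, and
they arise as soon as `-log δ_Ω` fails to be plurisubharmonic. -/
structure IsInnerTouchingDisc {E : Type*} [NormedAddCommGroup E] [NormedSpace ℂ E] (Ω : Set E)
    (ψ : ℂ → E) : Prop where
  differentiable : Differentiable ℂ ψ
  mem_frontier : ψ 0 ∈ frontier Ω
  exists_le_infDist : ∃ c > 0, ∀ᶠ σ in 𝓝 (0 : ℂ), c * ‖σ‖ ^ 2 ≤ infDist (ψ σ) Ωᶜ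

lemma mul_exp_neg_le_of_neg_log_le {a b t u : ℝ} (ha : 0 < a) (hb : 0 < b)
    (h : -Real.log b ≤ -Real.log a + t - u) : a * Real.exp (-t) * (1 + u) ≤ b := by
  calc a * Real.exp (-t) * (1 + u) ≤ a * Real.exp (-t) * Real.exp u := by
        gcongr
        linarith [Real.add_one_le_exp u]
    _ = Real.exp (Real.log a - t + u) := by
        rw [Real.exp_add, sub_eq_add_neg, Real.exp_add, Real.exp_log ha]
    _ ≤ Real.exp (Real.log b) := Real.exp_le_exp.2 (by linarith)
    _ = b := Real.exp_log hb

/-- If `p` is a boundary point closest to the touching point `x`, then `x - p` is rescaled by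
`exp (-F)` along the affine disc: this compensates the growth of `-log δ_Ω` up to the quadratic
term, which is what remains of the distance. -/
lemma exists_isInnerTouchingDisc {E : Type*} [NormedAddCommGroup E] [NormedSpace ℂ E]
    [FiniteDimensional ℂ E] {Ω : Set E} (hΩ : IsOpen Ω) (hne : Ω ≠ univ) {z w : E}
    (hzw : ∀ ζ ∈ closedBall (0 : ℂ) 1, z + ζ • w ∈ Ω)
    (h : Real.circleAverage (fun ζ : ℂ => negLogDistCompl Ω (z + ζ • w)) 0 1
      < negLogDistCompl Ω z) :
    ∃ ψ : ℂ → E, IsInnerTouchingDisc Ω ψ := by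
  obtain ⟨τ, hτ, c, hc, F, hF, hF0, htouch⟩ := exists_touching_of_circleAverage_lt
    (f := fun ζ : ℂ => negLogDistCompl Ω (z + ζ • w))
    ((continuousOn_negLogDistCompl hΩ hne).comp (by fun_prop) hzw) (by simpa using h)
  set x := z + τ • w with hx
  have hxΩ : x ∈ Ω := hzw τ (ball_subset_closedBall hτ)
  obtain ⟨p, hp, hxp⟩ := exists_mem_frontier_infDist_compl_eq_dist hxΩ hne
  set δ := infDist x Ωᶜ
  have hδ : 0 < δ := (mem_iff_infDist_compl_pos hΩ hne).1 hxΩ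
  refine ⟨fun σ => x + σ • w + Complex.exp (-F σ) • (p - x), by fun_prop, by simpa [hF0] using hp,
    δ * c / 2, by positivity, ?_⟩
  have hmem : ∀ᶠ σ in 𝓝 (0 : ℂ), x + σ • w ∈ Ω :=
    (show Continuous fun σ : ℂ => x + σ • w by fun_prop).tendsto' 0 x (by simp) (hΩ.mem_nhds hxΩ)
  have hexp : ∀ᶠ σ in 𝓝 (0 : ℂ), 1 / 2 < Real.exp (-(F σ).re) := by
    have hcont : Continuous fun σ => Real.exp (-(F σ).re) := by
      have := hF.continuous
      fun_prop
    exact hcont.tendsto' 0 1 (by simp [hF0]) (lt_mem_nhds (by norm_num))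
  filter_upwards [hmem, hexp, htouch] with σ hσ hexpσ htouchσ
  rw [show z + (τ + σ) • w = x + σ • w by rw [hx, add_smul, add_assoc]] at htouchσ
  have hlower : δ * Real.exp (-(F σ).re) * (1 + c * ‖σ‖ ^ 2) ≤ infDist (x + σ • w) Ωᶜ :=
    mul_exp_neg_le_of_neg_log_le hδ ((mem_iff_infDist_compl_pos hΩ hne).1 hσ) htouchσ
  have hupper : infDist (x + σ • w) Ωᶜ ≤
      infDist (x + σ • w + Complex.exp (-F σ) • (p - x)) Ωᶜ + δ * Real.exp (-(F σ).re) := by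
    refine (infDist_le_infDist_add_dist
      (y := x + σ • w + Complex.exp (-F σ) • (p - x))).trans_eq ?_
    rw [dist_self_add_right, norm_smul, Complex.norm_exp, Complex.neg_re, ← dist_eq_norm,
      dist_comm p, ← hxp, mul_comm δ]
  have hhalf : δ * (c * ‖σ‖ ^ 2) * (1 / 2) ≤ δ * (c * ‖σ‖ ^ 2) * Real.exp (-(F σ).re) := by gcongr
  linarith

/-! ### Estimates for the Kobayashi distance and the Kobayashi-Royden pseudometric -/

lemma le_artanh {x : ℝ} (h0 : 0 ≤ x) (h1 : x < 1) : x ≤ Real.artanh x := by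
  have h := Real.sum_range_le_log_div h0 h1 1
  rw [Real.artanh_eq_half_log ⟨by linarith, h1.le⟩]
  simpa [Finset.sum_range_one] using h

lemma dist_div_le_lempertFunction {n : ℕ} {Ω : Set (Cn n)} {C : ℝ} (hC0 : 0 < C)
    (hC : ∀ x ∈ Ω, ∀ y ∈ Ω, dist x y ≤ C) (x y : Cn n) :
    ENNReal.ofReal (dist x y / C) ≤ lempertFunction Ω x y := by
  refine le_iInf fun φ => le_iInf fun α => le_iInf fun ⟨⟨hφ, hmaps⟩, hα, hφ0, hφα⟩ => ?_
  have hα1 : ‖α‖ < 1 := by simpa using hα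
  have hschwarz : dist y x ≤ C * ‖α‖ := by
    simpa [hφ0, hφα] using Complex.dist_le_div_mul_dist_of_mapsTo_ball (R₂ := C) hφ
      (fun z hz => hC _ (hmaps hz) _ (hmaps (mem_ball_self one_pos))) hα
  refine ENNReal.ofReal_le_ofReal (le_trans ?_ (le_artanh (norm_nonneg α) hα1))
  rwa [div_le_iff₀' hC0, dist_comm]

lemma exists_mul_dist_le_kobayashiDist {n : ℕ} {Ω : Set (Cn n)} (hbdd : Bornology.IsBounded Ω) :
    ∃ m > 0, ∀ x y, ENNReal.ofReal (m * dist x y) ≤ kobayashiDist Ω x y := by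
  obtain ⟨C, hC0, hC⟩ : ∃ C > 0, ∀ x ∈ Ω, ∀ y ∈ Ω, dist x y ≤ C := by
    obtain ⟨C, hC⟩ := Metric.isBounded_iff.1 hbdd
    exact ⟨max C 1, by positivity, fun x hx y hy => (hC hx hy).trans (le_max_left _ _)⟩
  refine ⟨C⁻¹, by positivity, fun x y => ?_⟩
  refine le_iSup₂_of_le (fun x y => Real.toNNReal (C⁻¹ * dist x y))
    ⟨⟨by simp, fun x _ y _ => by rw [dist_comm], fun x _ y _ z _ => ?_⟩, fun x _ y _ => ?_⟩ le_rfl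
  · rw [← Real.toNNReal_add (by positivity) (by positivity), ← mul_add]
    gcongr
    exact dist_triangle x y z
  · simpa [ENNReal.ofReal, inv_mul_eq_div] using dist_div_le_lempertFunction hC0 hC x y

lemma kobayashiRoyden_le_of_mapsTo_ball {n : ℕ} {Ω : Set (Cn n)} {φ : ℂ → Cn n} {r : ℝ} (hr : 0 < r)
    (hφ : DifferentiableOn ℂ φ (ball 0 r)) (hmaps : MapsTo φ (ball 0 r) Ω) :
    kobayashiRoyden Ω (φ 0) (deriv φ 0) ≤ ENNReal.ofReal r⁻¹ := by
  have hball : MapsTo (fun ζ : ℂ => (r : ℂ) * ζ) (ball 0 1) (ball 0 r) := fun ζ hζ => by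
    simpa [abs_of_pos hr, hr] using hζ
  refine iInf₂_le_of_le (fun ζ : ℂ => φ (r * ζ)) (r : ℂ)⁻¹ (iInf_le_of_le
    ⟨⟨hφ.comp (by fun_prop) hball, hmaps.comp hball⟩, by simp, ?_⟩ ?_)
  · rw [deriv_comp_mul_left, mul_zero, inv_smul_smul₀ (by exact_mod_cast hr.ne')]
  · rw [← ofReal_norm, norm_inv, Complex.norm_real, Real.norm_of_nonneg hr.le]

/-! ### Second-order calculus -/

section Calculus

variable {E : Type*} [NormedAddCommGroup E] [NormedSpace ℝ E]

lemma deriv_deriv_nonpos_of_isLocalMax {f : ℝ → ℝ} {a : ℝ} (h : IsLocalMax f a)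
    (hf : ContinuousAt f a) : deriv (deriv f) a ≤ 0 := by
  by_contra! hpos
  have hmin : IsLocalMin f a := isLocalMin_of_deriv_deriv_pos hpos h.deriv_eq_zero hf
  have hconst : f =ᶠ[𝓝 a] fun _ => f a := by
    filter_upwards [h, hmin] with s hs hs' using le_antisymm hs hs'
  have hderiv : deriv f =ᶠ[𝓝 a] fun _ => 0 := by simpa using hconst.deriv
  rw [hderiv.deriv_eq, deriv_const] at hpos
  exact hpos.false

lemma image_le_of_second_deriv_nonpos {f f' f'' : ℝ → ℝ} {a b : ℝ} (hab : a ≤ b)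
    (hf : ∀ s ∈ Icc a b, HasDerivAt f (f' s) s) (hf' : ∀ s ∈ Icc a b, HasDerivAt f' (f'' s) s)
    (hf'' : ∀ s ∈ Icc a b, f'' s ≤ 0) (h0 : f' a = 0) : f b ≤ f a := by
  have hanti : ∀ {g g' : ℝ → ℝ}, (∀ s ∈ Icc a b, HasDerivAt g (g' s) s) →
      (∀ s ∈ Icc a b, g' s ≤ 0) → AntitoneOn g (Icc a b) := fun hg hg' =>
    antitoneOn_of_deriv_nonpos (convex_Icc a b)
      (fun s hs => (hg s hs).continuousAt.continuousWithinAt)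
      (fun s hs => (hg s (interior_subset hs)).differentiableAt.differentiableWithinAt)
      fun s hs => (hg s (interior_subset hs)).deriv.trans_le (hg' s (interior_subset hs))
  have ha : a ∈ Icc a b := left_mem_Icc.2 hab
  exact hanti hf (fun s hs => h0 ▸ hanti hf' hf'' ha hs hs.1) ha (right_mem_Icc.2 hab) hab

lemma hasDerivAt_comp_add_smul {F : Type*} [NormedAddCommGroup F] [NormedSpace ℝ F] {f : E → F}
    {x v : E} {s : ℝ} (hf : DifferentiableAt ℝ f (x + s • v)) :
    HasDerivAt (fun s : ℝ => f (x + s • v)) (fderiv ℝ f (x + s • v) v) s :=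
  hf.hasFDerivAt.comp_hasDerivAt s (by simpa using ((hasDerivAt_id s).smul_const v).const_add x)

lemma hasDerivAt_fderiv_comp_add_smul {f : E → ℝ} {x v : E} {s : ℝ}
    (hf : ContDiffAt ℝ 2 f (x + s • v)) :
    HasDerivAt (fun s : ℝ => fderiv ℝ f (x + s • v) v)
      (fderiv ℝ (fderiv ℝ f) (x + s • v) v v) s := by
  have hf' : DifferentiableAt ℝ (fderiv ℝ f) (x + s • v) :=
    (hf.fderiv_right (m := 1) (by norm_num)).differentiableAt one_ne_zero
  simpa using (hasDerivAt_comp_add_smul hf').clm_apply (hasDerivAt_const s v)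

lemma fderiv_fderiv_apply_le_of_eventually_le {f : E → ℝ} {x v : E} (hf : ContDiffAt ℝ 2 f x)
    {c : ℝ} (h : ∀ᶠ s : ℝ in 𝓝 0, f (x + s • v) ≤ f x - c * s ^ 2) :
    fderiv ℝ (fderiv ℝ f) x v v ≤ -(2 * c) := by
  have hline : ∀ᶠ s : ℝ in 𝓝 0, ContDiffAt ℝ 2 f (x + s • v) :=
    (show Continuous fun s : ℝ => x + s • v by fun_prop).tendsto' 0 x (by simp)
      (hf.eventually (by simp))
  set g : ℝ → ℝ := fun s => f (x + s • v) + c * s ^ 2 with hg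
  have hderiv : ∀ᶠ s in 𝓝 0, HasDerivAt g (fderiv ℝ f (x + s • v) v + c * (2 * s)) s := by
    filter_upwards [hline] with s hs
    exact (hasDerivAt_comp_add_smul (hs.differentiableAt two_ne_zero)).add
      (by simpa using (hasDerivAt_pow 2 s).const_mul c)
  have hderiv2 : deriv (deriv g) 0 = fderiv ℝ (fderiv ℝ f) x v v + c * 2 := by
    have hH := hasDerivAt_fderiv_comp_add_smul hline.self_of_nhds
    have hlin : HasDerivAt (fun s : ℝ => c * (2 * s)) (c * 2) 0 := by
      simpa using ((hasDerivAt_id (0 : ℝ)).const_mul 2).const_mul c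
    have heq : deriv g =ᶠ[𝓝 0] fun s => fderiv ℝ f (x + s • v) v + c * (2 * s) :=
      hderiv.mono fun s hs => hs.deriv
    rw [heq.deriv_eq, (hH.fun_add hlin).deriv, zero_smul, add_zero]
  have hmax : IsLocalMax g 0 := by
    filter_upwards [h] with s hs
    simp only [hg, zero_smul, add_zero]
    linarith
  have hle := deriv_deriv_nonpos_of_isLocalMax hmax hderiv.self_of_nhds.continuousAt
  linarith

set_option maxSynthPendingDepth 3 in
lemma eventually_fderiv_fderiv_apply_nonpos {f : E → ℝ} {x : E} (hf : ContDiffAt ℝ 2 f x) {c : ℝ}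
    (hc : 0 < c) :
    ∀ᶠ y in 𝓝 x, ∀ v, fderiv ℝ (fderiv ℝ f) x v v ≤ -(c * ‖v‖ ^ 2) →
      fderiv ℝ (fderiv ℝ f) y v v ≤ 0 := by
  have hcont : ContinuousAt (fderiv ℝ (fderiv ℝ f)) x :=
    ((hf.fderiv_right (m := 1) (by norm_num)).fderiv_right (m := 0) (by norm_num)).continuousAt
  filter_upwards [Metric.continuousAt_iff'.1 hcont c hc] with y hy v hv
  rw [dist_eq_norm] at hy
  have hdiff : ‖(fderiv ℝ (fderiv ℝ f) y - fderiv ℝ (fderiv ℝ f) x) v v‖ ≤ c * ‖v‖ ^ 2 := by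
    calc _ ≤ ‖fderiv ℝ (fderiv ℝ f) y - fderiv ℝ (fderiv ℝ f) x‖ * ‖v‖ * ‖v‖ :=
          ContinuousLinearMap.le_opNorm₂ _ v v
      _ ≤ c * ‖v‖ * ‖v‖ := by gcongr
      _ = c * ‖v‖ ^ 2 := by ring
  have := (le_abs_self _).trans hdiff
  simp only [sub_apply] at this
  linarith

/-- The size of the neighbourhood on which a critical point stays a maximum is locally uniform in
the parameter, as the second derivative remains nonpositive along the segments issuing from it. -/
lemma eventually_apply_le_of_fderiv_eq_zero {W : Type*} [NormedAddCommGroup W] [NormedSpace ℝ W]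
    {G : E × W → ℝ} {x₀ : E} (hG : ContDiffAt ℝ 2 G (x₀, 0)) {c : ℝ} (hc : 0 < c)
    (h : ∀ᶠ τ in 𝓝 (0 : W), G (x₀, τ) ≤ G (x₀, 0) - c * ‖τ‖ ^ 2) :
    ∀ᶠ y in 𝓝 (x₀, (0 : W)), fderiv ℝ (fun τ => G (y.1, τ)) 0 = 0 → G y ≤ G (y.1, 0) := by
  have hneg : ∀ e : W, fderiv ℝ (fderiv ℝ G) (x₀, 0) (0, e) (0, e) ≤
      -(2 * c * ‖((0 : E), e)‖ ^ 2) := fun e => by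
    have htendsto : Tendsto (fun s : ℝ => s • e) (𝓝 0) (𝓝 0) :=
      (show Continuous fun s : ℝ => s • e by fun_prop).tendsto' 0 0 (by simp)
    refine (fderiv_fderiv_apply_le_of_eventually_le hG (c := c * ‖e‖ ^ 2) ?_).trans_eq
      (by simp [mul_assoc])
    filter_upwards [htendsto.eventually h] with s hs
    simpa [norm_smul, mul_pow, mul_assoc, mul_comm (‖e‖ ^ 2)] using hs
  have hseg : ∀ᶠ y in 𝓝 (x₀, (0 : W)), ∀ s ∈ Icc (0 : ℝ) 1,
      ContDiffAt ℝ 2 G (y.1, s • y.2) ∧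
        fderiv ℝ (fderiv ℝ G) (y.1, s • y.2) (0, y.2) (0, y.2) ≤ 0 := by
    refine isCompact_Icc.eventually_forall_of_forall_eventually fun s _ => ?_
    have htendsto : Tendsto (fun q : (E × W) × ℝ => (q.1.1, q.2 • q.1.2)) (𝓝 ((x₀, 0), s))
        (𝓝 (x₀, 0)) := (show Continuous fun q : (E × W) × ℝ => (q.1.1, q.2 • q.1.2) by
          fun_prop).tendsto' _ _ (by simp)
    filter_upwards [htendsto.eventually (hG.eventually (by simp)), htendsto.eventually
      (eventually_fderiv_fderiv_apply_nonpos hG (by positivity : 0 < 2 * c))] with q hq hq'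
    exact ⟨hq, hq' _ (hneg _)⟩
  filter_upwards [hseg] with y hy hcrit
  have hline : ∀ s : ℝ, (y.1, s • y.2) = (y.1, (0 : W)) + s • ((0 : E), y.2) := fun s => by simp
  simp only [hline] at hy
  have hderiv := fun s hs => hasDerivAt_comp_add_smul ((hy s hs).1.differentiableAt two_ne_zero)
  have h0 : fderiv ℝ G ((y.1, (0 : W)) + (0 : ℝ) • ((0 : E), y.2)) (0, y.2) = 0 := by
    refine (hderiv 0 (by simp)).unique ?_
    have hslice : DifferentiableAt ℝ (fun τ => G (y.1, τ)) 0 := by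
      refine DifferentiableAt.comp (g := G) (0 : W) ?_ (by fun_prop)
      simpa using (hy 0 (by simp)).1.differentiableAt two_ne_zero
    simpa [hcrit] using hasDerivAt_comp_add_smul (x := (0 : W)) (v := y.2) (s := 0)
      (f := fun τ => G (y.1, τ)) (by simpa using hslice)
  simpa using image_le_of_second_deriv_nonpos zero_le_one hderiv
    (fun s hs => hasDerivAt_fderiv_comp_add_smul (hy s hs).1) (fun s hs => (hy s hs).2) h0

lemma eventually_apply_add_smul_le {f : E → ℝ} {f' : E →L[ℝ] ℝ} {p v : E} {m : ℝ}
    (hf : HasStrictFDerivAt f f' p) (hm : f' v < m) :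
    ∀ᶠ z : E × ℝ in 𝓝 (p, 0), 0 ≤ z.2 → f (z.1 + z.2 • v) ≤ f z.1 + m * z.2 := by
  have htendsto : Tendsto (fun z : E × ℝ => (z.1 + z.2 • v, z.1)) (𝓝 (p, 0)) (𝓝 (p, p)) :=
    (show Continuous fun z : E × ℝ => (z.1 + z.2 • v, z.1) by fun_prop).tendsto' _ _ (by simp)
  have hsmul : (fun z : E × ℝ => z.1 + z.2 • v - z.1) =O[𝓝 (p, 0)] fun z => z.2 :=
    Asymptotics.IsBigO.of_bound ‖v‖ (Eventually.of_forall fun z => by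
      rw [add_sub_cancel_left, norm_smul, mul_comm])
  have hlittle := (hf.isLittleO.comp_tendsto htendsto).trans_isBigO hsmul
  filter_upwards [hlittle.bound (sub_pos.2 hm)] with z hz hz0
  simp only [Function.comp_apply, add_sub_cancel_left, map_smul, smul_eq_mul, Real.norm_eq_abs,
    abs_of_nonneg hz0] at hz
  linarith [le_of_abs_le hz]

end Calculus

/-! ### Complex tangent directions along the boundary -/

/-- A local `C²` defining function of `Ω` at its boundary point `p`, stated pointwise at `p` and
with germs at `p` instead of a fixed neighbourhood. -/
structure IsDefiningFunctionAt {E : Type*} [NormedAddCommGroup E] [NormedSpace ℝ E] (Ω : Set E)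
    (ρ : E → ℝ) (p : E) : Prop where
  contDiffAt : ContDiffAt ℝ 2 ρ p
  apply_eq_zero : ρ p = 0
  fderiv_ne_zero : fderiv ℝ ρ p ≠ 0
  eventually_mem_iff : ∀ᶠ x in 𝓝 p, x ∈ Ω ↔ ρ x < 0

lemma HasC2Boundary.exists_isDefiningFunctionAt {n : ℕ} {Ω : Set (Cn n)} (hC2 : HasC2Boundary Ω)
    (hΩ : IsOpen Ω) {p : Cn n} (hp : p ∈ frontier Ω) : ∃ ρ, IsDefiningFunctionAt Ω ρ p := by
  obtain ⟨U, ρ, hUo, hpU, hρ, hdρ, hΩU⟩ := hC2 p hp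
  have hU : U ∈ 𝓝 p := hUo.mem_nhds hpU
  have hmem : ∀ x ∈ U, x ∈ Ω ↔ ρ x < 0 := fun x hx => by
    simpa [hx] using congrArg (x ∈ ·) hΩU
  have hcont : ContDiffAt ℝ 2 ρ p := hρ.contDiffAt hU
  rw [hΩ.frontier_eq] at hp
  have hnonpos : ρ p ≤ 0 := le_of_tendsto_of_frequently hcont.continuousAt <|
    ((mem_closure_iff_frequently.1 hp.1).and_eventually hU).mono fun x hx =>
      ((hmem x hx.2).1 hx.1).le
  exact ⟨ρ, hcont, hnonpos.antisymm (not_lt.1 fun hlt => hp.2 ((hmem p hpU).2 hlt)), hdρ p hpU,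
    eventually_of_mem hU hmem⟩

namespace IsDefiningFunctionAt

section Real

variable {E : Type*} [NormedAddCommGroup E] [NormedSpace ℝ E] {Ω : Set E} {ρ : E → ℝ} {p : E}

lemma hasStrictFDerivAt (h : IsDefiningFunctionAt Ω ρ p) :
    HasStrictFDerivAt ρ (fderiv ℝ ρ p) p :=
  h.contDiffAt.hasStrictFDerivAt two_ne_zero

lemma exists_norm_lt_one_fderiv_neg (h : IsDefiningFunctionAt Ω ρ p) :
    ∃ v, ‖v‖ < 1 ∧ fderiv ℝ ρ p v < 0 := by
  obtain ⟨v, hv, hne⟩ := (fderiv ℝ ρ p).exists_lt_apply_of_lt_opNorm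
    (norm_pos_iff.2 h.fderiv_ne_zero)
  rcases lt_or_gt_of_ne (norm_pos_iff.1 hne) with hneg | hpos
  · exact ⟨v, hv, hneg⟩
  · exact ⟨-v, by rwa [norm_neg], by simpa using hpos⟩

lemma exists_le_neg_mul_infDist (h : IsDefiningFunctionAt Ω ρ p) :
    ∃ c > 0, ∀ᶠ x in 𝓝 p, x ∈ Ω → ρ x ≤ -(c * infDist x Ωᶜ) := by
  obtain ⟨v, hv, hneg⟩ := h.exists_norm_lt_one_fderiv_neg
  have hp : p ∈ Ωᶜ := fun hp => (h.eventually_mem_iff.self_of_nhds.1 hp).ne h.apply_eq_zero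
  have hcont : Continuous fun x => x - infDist x Ωᶜ • v := by
    have := continuous_infDist_pt Ωᶜ
    fun_prop
  have htendsto : Tendsto (fun x => x - infDist x Ωᶜ • v) (𝓝 p) (𝓝 p) :=
    hcont.tendsto' p p (by simp [infDist_zero_of_mem hp])
  have hdist : Tendsto (fun x => infDist x Ωᶜ) (𝓝 p) (𝓝 0) :=
    (continuous_infDist_pt _).tendsto' p 0 (infDist_zero_of_mem hp)
  refine ⟨-(fderiv ℝ ρ p v / 2), by linarith, ?_⟩
  filter_upwards [htendsto.eventually h.eventually_mem_iff, (htendsto.prodMk_nhds hdist).eventually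
    (eventually_apply_add_smul_le h.hasStrictFDerivAt (show fderiv ℝ ρ p v < fderiv ℝ ρ p v / 2 by
      linarith))] with x hmem hle hx
  have hshift : x - infDist x Ωᶜ • v ∈ Ω := by
    rcases (infDist_nonneg (x := x) (s := Ωᶜ)).eq_or_lt with h0 | hpos
    · rwa [← h0, zero_smul, sub_zero]
    · refine notMem_compl_iff.1 (notMem_of_dist_lt_infDist (x := x) ?_)
      rw [dist_self_sub_right, norm_smul, Real.norm_of_nonneg hpos.le]
      exact mul_lt_of_lt_one_right hpos hv
  have hle' := hle infDist_nonneg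
  rw [sub_add_cancel] at hle'
  linarith [hmem.1 hshift]

end Real

lemma exists_comp_le_sub_sq {E : Type*} [NormedAddCommGroup E] [NormedSpace ℂ E] {Ω : Set E}
    {ρ : E → ℝ} {ψ : ℂ → E} (h : IsDefiningFunctionAt Ω ρ (ψ 0)) (hψ : IsInnerTouchingDisc Ω ψ) :
    ∃ c > 0, ∀ᶠ σ in 𝓝 (0 : ℂ), ρ (ψ σ) ≤ ρ (ψ 0) - c * ‖σ‖ ^ 2 := by
  obtain ⟨c, hc, hdist⟩ := hψ.exists_le_infDist
  obtain ⟨k, hk, hle⟩ := h.exists_le_neg_mul_infDist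
  refine ⟨k * c, by positivity, ?_⟩
  filter_upwards [hdist, (hψ.differentiable.continuous.tendsto 0).eventually hle] with σ hσ hleσ
  rcases eq_or_ne σ 0 with rfl | hne
  · simp
  have hmem : ψ σ ∈ Ω := by
    by_contra hn
    rw [infDist_zero_of_mem (mem_compl hn)] at hσ
    exact hσ.not_gt (by positivity)
  calc ρ (ψ σ) ≤ -(k * infDist (ψ σ) Ωᶜ) := hleσ hmem
    _ ≤ -(k * (c * ‖σ‖ ^ 2)) := by gcongr
    _ = ρ (ψ 0) - k * c * ‖σ‖ ^ 2 := by rw [h.apply_eq_zero]; ring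

end IsDefiningFunctionAt

section ComplexTangent

variable {E : Type*} [NormedAddCommGroup E] [NormedSpace ℂ E]

lemma exists_tendsto_inv_sq_smul_sub_of_deriv_eq_zero [CompleteSpace E] {ψ : ℂ → E}
    (hψ : Differentiable ℂ ψ) (h0 : deriv ψ 0 = 0) :
    ∃ a, Tendsto (fun s : ℂ => (s ^ 2)⁻¹ • (ψ s - ψ 0)) (𝓝[≠] 0) (𝓝 a) := by
  have hdslope : ∀ {f : ℂ → E}, Differentiable ℂ f → Differentiable ℂ (dslope f 0) := fun hf =>
    differentiableOn_univ.1 ((Complex.differentiableOn_dslope univ_mem).2 hf.differentiableOn)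
  refine ⟨dslope (dslope ψ 0) 0 0, (((hdslope (hdslope hψ)).continuous.tendsto 0).mono_left
    nhdsWithin_le_nhds).congr' ?_⟩
  filter_upwards [self_mem_nhdsWithin] with s hs
  rw [dslope_of_ne _ hs, slope_def_module, dslope_same, h0, dslope_of_ne _ hs, slope_def_module,
    sub_zero, sub_zero, smul_smul, pow_two, mul_inv]

lemma fderiv_sq_smul_le_of_eventually_le_sub_sq {f : E → ℝ} {ψ : ℂ → E} {a : E}
    (hψ : ContinuousAt ψ 0) (hf : DifferentiableAt ℝ f (ψ 0))
    (ha : Tendsto (fun s : ℂ => (s ^ 2)⁻¹ • (ψ s - ψ 0)) (𝓝[≠] 0) (𝓝 a)) {c : ℝ}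
    (h : ∀ᶠ σ in 𝓝 (0 : ℂ), f (ψ σ) ≤ f (ψ 0) - c * ‖σ‖ ^ 2) {u : ℂ} (hu : u ≠ 0) :
    fderiv ℝ f (ψ 0) (u ^ 2 • a) ≤ -(c * ‖u‖ ^ 2) := by
  have hray0 : Tendsto (fun s : ℝ => (s : ℂ) * u) (𝓝[≠] 0) (𝓝 0) :=
    ((show Continuous fun s : ℝ => (s : ℂ) * u by fun_prop).tendsto' 0 0 (by simp)).mono_left
      nhdsWithin_le_nhds
  have hray : Tendsto (fun s : ℝ => (s : ℂ) * u) (𝓝[≠] 0) (𝓝[≠] 0) :=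
    tendsto_nhdsWithin_iff.2
      ⟨hray0, eventually_mem_nhdsWithin.mono fun s hs => by simpa [hu] using hs⟩
  have hcd : Tendsto (fun s : ℝ => (s ^ 2)⁻¹ • (ψ (s * u) - ψ 0)) (𝓝[≠] 0) (𝓝 (u ^ 2 • a)) := by
    refine ((ha.comp hray).const_smul (u ^ 2)).congr fun s => ?_
    rw [Function.comp_apply, smul_smul, ← Complex.coe_smul]
    congr 1
    push_cast
    field_simp
  have hd : Tendsto (fun s : ℝ => ψ (s * u) - ψ 0) (𝓝[≠] 0) (𝓝 0) := by
    simpa using (hψ.tendsto.comp hray0).sub_const (ψ 0)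
  refine le_of_tendsto
    (hf.hasFDerivAt.hasFDerivWithinAt.lim (s := univ) hd (Eventually.of_forall fun _ => mem_univ _)
      hcd) ?_
  filter_upwards [hray0.eventually h, self_mem_nhdsWithin] with s hs hs0
  have hs2 : 0 < s ^ 2 := by have : s ≠ 0 := hs0; positivity
  rw [add_sub_cancel, smul_eq_mul, inv_mul_le_iff₀ hs2]
  simp only [norm_mul, Complex.norm_real, Real.norm_eq_abs, mul_pow, sq_abs] at hs
  linarith

/-- A vanishing derivative would make the disc `ψ 0 + s² a` up to higher order, and by the quadratic
decay of `f` the derivative of `f` would be negative along both `a` and `-a = I² a`. -/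
lemma deriv_ne_zero_of_eventually_le_sub_sq [CompleteSpace E] {f : E → ℝ} {ψ : ℂ → E}
    (hψ : Differentiable ℂ ψ) (hf : DifferentiableAt ℝ f (ψ 0)) {c : ℝ} (hc : 0 < c)
    (h : ∀ᶠ σ in 𝓝 (0 : ℂ), f (ψ σ) ≤ f (ψ 0) - c * ‖σ‖ ^ 2) : deriv ψ 0 ≠ 0 := by
  intro h0
  obtain ⟨a, ha⟩ := exists_tendsto_inv_sq_smul_sub_of_deriv_eq_zero hψ h0
  have hle {u : ℂ} (hu : u ≠ 0) := fderiv_sq_smul_le_of_eventually_le_sub_sq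
    hψ.continuous.continuousAt hf ha h hu
  have hone := hle one_ne_zero
  have hI := hle Complex.I_ne_zero
  simp only [one_pow, one_smul, norm_one, Complex.I_sq, Complex.norm_I, neg_smul, map_neg]
    at hone hI
  linarith

/-- The vector `w` is complex tangent at `x` to the level set of `ρ`: the complex line spanned
by `w` lies in the kernel of the real differential of `ρ`. -/
def IsComplexTangent (ρ : E → ℝ) (x w : E) : Prop :=
  ∀ ζ : ℂ, fderiv ℝ ρ x (ζ • w) = 0

lemma isComplexTangent_iff_fderiv_comp_eq_zero {ρ : E → ℝ} {ψ : ℂ → E} {w : E}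
    (hρ : DifferentiableAt ℝ ρ (ψ 0)) (hψ : HasDerivAt ψ w 0) :
    IsComplexTangent ρ (ψ 0) w ↔ fderiv ℝ (fun σ => ρ (ψ σ)) 0 = 0 := by
  have hcomp : HasFDerivAt (fun σ => ρ (ψ σ)) ((fderiv ℝ ρ (ψ 0)).comp
      ((ContinuousLinearMap.toSpanSingleton ℂ w).restrictScalars ℝ)) 0 :=
    hρ.hasFDerivAt.comp (0 : ℂ) (hψ.hasFDerivAt.restrictScalars ℝ)
  rw [hcomp.fderiv, ContinuousLinearMap.ext_iff]
  rfl

lemma isComplexTangent_iff_extendRCLike_eq_zero {ρ : E → ℝ} {x w : E} :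
    IsComplexTangent ρ x w ↔ StrongDual.extendRCLike (𝕜 := ℂ) (fderiv ℝ ρ x) w = 0 := by
  refine ⟨fun h => ?_, fun h ζ => ?_⟩
  · have h1 : fderiv ℝ ρ x w = 0 := by simpa using h 1
    simp [StrongDual.extendRCLike_apply, h1, h Complex.I]
  · rw [← StrongDual.re_extendRCLike_apply (𝕜 := ℂ), map_smul, h, smul_zero, map_zero]

lemma exists_contDiffAt_isComplexTangent {ρ : E → ℝ} {p w₀ : E} (hρ : ContDiffAt ℝ 2 ρ p)
    (hD : fderiv ℝ ρ p ≠ 0) (hw₀ : IsComplexTangent ρ p w₀) :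
    ∃ w : E → E, ContDiffAt ℝ 1 w p ∧ w p = w₀ ∧ ∀ᶠ x in 𝓝 p, IsComplexTangent ρ x (w x) := by
  obtain ⟨v, hv⟩ := DFunLike.ne_iff.1 hD
  set θ : E → StrongDual ℂ E := fun x => StrongDual.extendRCLike (fderiv ℝ ρ x)
  have hθv : θ p v ≠ 0 := fun h0 => hv (by
    simpa using isComplexTangent_iff_extendRCLike_eq_zero.2 h0 1)
  have hθ : ContDiffAt ℝ 1 θ p :=
    (StrongDual.extendRCLikeₗᵢ (𝕜 := ℂ) (F := E)).toContinuousLinearEquiv.contDiff.contDiffAt.comp p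
      (hρ.fderiv_right (by norm_num))
  have hθ_apply : ∀ e, ContDiffAt ℝ 1 (fun x => θ x e) p := fun e =>
    ((ContinuousLinearMap.apply ℂ ℂ e).restrictScalars ℝ).contDiff.contDiffAt.comp p hθ
  refine ⟨fun x => w₀ - (θ x w₀ / θ x v) • v, ?_, ?_, ?_⟩
  · simp only [div_eq_mul_inv]
    exact contDiffAt_const.sub ((((hθ_apply w₀).mul ((hθ_apply v).inv hθv))).smul contDiffAt_const)
  · simp [show θ p w₀ = 0 from isComplexTangent_iff_extendRCLike_eq_zero.1 hw₀]
  · filter_upwards [(hθ_apply v).continuousAt.eventually_ne hθv] with x hx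
    exact isComplexTangent_iff_extendRCLike_eq_zero.2 (show θ x _ = 0 by simp [hx])

lemma exists_isComplexTangent_curve [CompleteSpace E] {ρ : E → ℝ} {p w₀ : E}
    (hρ : ContDiffAt ℝ 2 ρ p) (hD : fderiv ℝ ρ p ≠ 0) (hw₀ : IsComplexTangent ρ p w₀) :
    ∃ γ : ℝ → E, γ 0 = p ∧ HasStrictDerivAt γ w₀ 0 ∧ ContinuousAt (deriv γ) 0 ∧
      ∀ᶠ s in 𝓝 0, ρ (γ s) = ρ p ∧ IsComplexTangent ρ (γ s) (deriv γ s) := by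
  obtain ⟨w, hw, hwp, htan⟩ := exists_contDiffAt_isComplexTangent hρ hD hw₀
  obtain ⟨γ, rfl, hγ⟩ := hw.exists_forall_mem_closedBall_exists_eq_forall_mem_Ioo_hasDerivAt₀ 0
  simp_rw [← Real.ball_eq_Ioo, ← Metric.eventually_nhds_iff_ball] at hγ
  have hcont : ContinuousAt γ 0 := hγ.self_of_nhds.continuousAt
  have hwγ : ContinuousAt (fun s => w (γ s)) 0 := hw.continuousAt.comp hcont
  have hderiv : deriv γ =ᶠ[𝓝 0] fun s => w (γ s) := hγ.mono fun s hs => hs.deriv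
  refine ⟨γ, rfl, hwp ▸ hasStrictDerivAt_of_hasDerivAt_of_continuousAt hγ hwγ,
    hwγ.congr hderiv.symm, ?_⟩
  have hdiff : ∀ᶠ s in 𝓝 (0 : ℝ), HasDerivAt (fun s => ρ (γ s)) 0 s := by
    filter_upwards [hγ, hcont.eventually htan, hcont.eventually (hρ.eventually (by simp))]
      with s hs htans hρs
    have := (hρs.differentiableAt two_ne_zero).hasFDerivAt.comp_hasDerivAt s hs
    rwa [show fderiv ℝ ρ (γ s) (w (γ s)) = 0 by simpa using htans 1] at this
  obtain ⟨r, hr, hball⟩ := Metric.eventually_nhds_iff_ball.1 hdiff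
  filter_upwards [ball_mem_nhds (0 : ℝ) hr, hcont.eventually htan, hderiv] with s hs htans hderivs
  refine ⟨?_, by rwa [hderivs]⟩
  exact isOpen_ball.is_const_of_deriv_eq_zero (convex_ball (0 : ℝ) r).isPreconnected
    (fun s hs => (hball s hs).differentiableAt.differentiableWithinAt)
    (fun s hs => (hball s hs).deriv) hs (mem_ball_self hr)

end ComplexTangent

section DiscThrough

variable {E : Type*} [NormedAddCommGroup E] [NormedSpace ℂ E] {ψ : ℂ → E}

/-- The perturbation of the disc `ψ` by an affine map which passes through `x` with derivative `w`
at the origin. It carries a disc at one boundary point to discs at all nearby boundary points. -/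
noncomputable def discThrough (ψ : ℂ → E) (x w : E) (σ : ℂ) : E :=
  ψ σ + (x - ψ 0) + σ • (w - deriv ψ 0)

lemma discThrough_zero (ψ : ℂ → E) (x w : E) : discThrough ψ x w 0 = x := by
  simp [discThrough]

lemma discThrough_self (ψ : ℂ → E) : discThrough ψ (ψ 0) (deriv ψ 0) = ψ := by
  ext σ
  simp [discThrough]

lemma hasDerivAt_discThrough (hψ : DifferentiableAt ℂ ψ 0) (x w : E) :
    HasDerivAt (discThrough ψ x w) w 0 := by
  refine ((hψ.hasDerivAt.add_const (x - ψ 0)).add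
    ((hasDerivAt_id (0 : ℂ)).smul_const (w - deriv ψ 0))).congr_deriv ?_
  rw [one_smul, add_sub_cancel]

lemma differentiable_discThrough (hψ : Differentiable ℂ ψ) (x w : E) :
    Differentiable ℂ (discThrough ψ x w) := by
  unfold discThrough
  fun_prop

lemma contDiff_discThrough [CompleteSpace E] (hψ : Differentiable ℂ ψ) :
    ContDiff ℝ 2 fun y : (E × E) × ℂ => discThrough ψ y.1.1 y.1.2 y.2 := by
  have hψ2 : ContDiff ℝ 2 ψ := (hψ.contDiff (n := 2)).restrict_scalars ℝ
  unfold discThrough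
  fun_prop

lemma eventually_apply_discThrough_le [CompleteSpace E] (hψ : Differentiable ℂ ψ) {ρ : E → ℝ}
    (hρ : ContDiffAt ℝ 2 ρ (ψ 0)) {c : ℝ} (hc : 0 < c)
    (h : ∀ᶠ σ in 𝓝 (0 : ℂ), ρ (ψ σ) ≤ ρ (ψ 0) - c * ‖σ‖ ^ 2) :
    ∀ᶠ y : (E × E) × ℂ in 𝓝 ((ψ 0, deriv ψ 0), 0), IsComplexTangent ρ y.1.1 y.1.2 →
      ρ (discThrough ψ y.1.1 y.1.2 y.2) ≤ ρ y.1.1 := by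
  have hG : ContDiffAt ℝ 2 (fun y : (E × E) × ℂ => ρ (discThrough ψ y.1.1 y.1.2 y.2))
      ((ψ 0, deriv ψ 0), 0) :=
    ContDiffAt.comp _ (by simpa [discThrough_zero] using hρ) (contDiff_discThrough hψ).contDiffAt
  have hbase : Tendsto (fun y : (E × E) × ℂ => y.1.1) (𝓝 ((ψ 0, deriv ψ 0), 0)) (𝓝 (ψ 0)) :=
    continuous_fst.fst.tendsto' _ _ rfl
  filter_upwards [eventually_apply_le_of_fderiv_eq_zero hG hc
    (by simpa [discThrough_self] using h), hbase.eventually (hρ.eventually (by simp))]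
    with y hle hρy htan
  simp only [discThrough_zero] at hle
  refine hle ((isComplexTangent_iff_fderiv_comp_eq_zero ?_
    (hasDerivAt_discThrough (hψ 0) y.1.1 y.1.2)).1 ?_)
  · simpa [discThrough_zero] using hρy.differentiableAt two_ne_zero
  · rwa [discThrough_zero]

lemma IsDefiningFunctionAt.eventually_discThrough_add_smul_mem [CompleteSpace E] {Ω : Set E}
    {ρ : E → ℝ} (h : IsDefiningFunctionAt Ω ρ (ψ 0)) (hψ : IsInnerTouchingDisc Ω ψ) {v : E}
    (hv : fderiv ℝ ρ (ψ 0) v < 0) :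
    ∀ᶠ z : ((E × E) × ℂ) × ℝ in 𝓝 (((ψ 0, deriv ψ 0), 0), 0),
      IsComplexTangent ρ z.1.1.1 z.1.1.2 → ρ z.1.1.1 = 0 → 0 < z.2 →
        discThrough ψ z.1.1.1 z.1.1.2 z.1.2 + z.2 • v ∈ Ω := by
  obtain ⟨c, hc, hdecay⟩ := h.exists_comp_le_sub_sq hψ
  have hle := (eventually_apply_discThrough_le hψ.differentiable h.contDiffAt hc
    hdecay).prod_inl_nhds (0 : ℝ)
  set disc : ((E × E) × ℂ) × ℝ → E := fun z => discThrough ψ z.1.1.1 z.1.1.2 z.1.2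
  have hdisc : Continuous disc :=
    (contDiff_discThrough hψ.differentiable).continuous.comp continuous_fst
  have hpush := ((hdisc.prodMk continuous_snd).tendsto' (((ψ 0, deriv ψ 0), 0), 0) (ψ 0, 0) (by
    simp [disc, discThrough_zero])).eventually (eventually_apply_add_smul_le h.hasStrictFDerivAt
      (show fderiv ℝ ρ (ψ 0) v < fderiv ℝ ρ (ψ 0) v / 2 by linarith))
  have hpushed : Continuous fun z => disc z + z.2 • v :=
    hdisc.add (continuous_snd.smul continuous_const)
  have hmem := (hpushed.tendsto' (((ψ 0, deriv ψ 0), 0), 0) (ψ 0) (by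
    simp [disc, discThrough_zero])).eventually h.eventually_mem_iff
  filter_upwards [hle, hpush, hmem] with z hlez hpushz hmemz htan hzero hpos
  refine hmemz.2 ?_
  have hneg : fderiv ℝ ρ (ψ 0) v / 2 * z.2 < 0 := mul_neg_of_neg_of_pos (by linarith) hpos
  linarith [hlez htan, hpushz hpos.le]

end DiscThrough

/-! ### Curves sliding along the boundary -/

lemma IsDefiningFunctionAt.isComplexTangent_deriv {E : Type*} [NormedAddCommGroup E]
    [NormedSpace ℂ E] {Ω : Set E} {ρ : E → ℝ} {ψ : ℂ → E} (h : IsDefiningFunctionAt Ω ρ (ψ 0))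
    (hψ : IsInnerTouchingDisc Ω ψ) : IsComplexTangent ρ (ψ 0) (deriv ψ 0) := by
  obtain ⟨c, hc, hdecay⟩ := h.exists_comp_le_sub_sq hψ
  have hmax : IsLocalMax (fun σ => ρ (ψ σ)) 0 :=
    hdecay.mono fun σ hσ => hσ.trans (sub_le_self _ (by positivity))
  exact (isComplexTangent_iff_fderiv_comp_eq_zero (h.contDiffAt.differentiableAt two_ne_zero)
    (hψ.differentiable 0).hasDerivAt).2 hmax.fderiv_eq_zero

/-- The curve `γ` runs outside `Ω` for small parameters, while its small translates in the
direction `v` run inside `Ω` with Kobayashi-Royden speed at most `A`. -/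
structure IsSlidingCurve {n : ℕ} (Ω : Set (Cn n)) (γ : ℝ → Cn n) (v : Cn n) (A : ℝ) : Prop where
  hasStrictDerivAt : HasStrictDerivAt γ (deriv γ 0) 0
  deriv_ne_zero : deriv γ 0 ≠ 0
  eventually_notMem : ∀ᶠ s in 𝓝 0, γ s ∉ Ω
  eventually_mem_and_speed_le : ∀ᶠ z : ℝ × ℝ in 𝓝 0 ×ˢ 𝓝[>] 0, γ z.1 + z.2 • v ∈ Ω ∧
    kobayashiRoyden Ω (γ z.1 + z.2 • v) (deriv γ z.1) ≤ ENNReal.ofReal A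

section SlidingCurve

variable {n : ℕ} {Ω : Set (Cn n)}

lemma kobayashiRoyden_add_smul_le_of_discThrough_mem {ψ : ℂ → Cn n} (hψ : Differentiable ℂ ψ)
    {x w u : Cn n} {r : ℝ} (hr : 0 < r) (h : ∀ σ ∈ ball 0 r, discThrough ψ x w σ + u ∈ Ω) :
    kobayashiRoyden Ω (x + u) w ≤ ENNReal.ofReal r⁻¹ := by
  have hdiff := (differentiable_discThrough hψ x w).add_const u
  simpa [discThrough_zero, (hasDerivAt_discThrough (hψ 0) x w).deriv] using
    kobayashiRoyden_le_of_mapsTo_ball hr hdiff.differentiableOn h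

lemma IsInnerTouchingDisc.exists_isSlidingCurve {ψ : ℂ → Cn n} (hψ : IsInnerTouchingDisc Ω ψ)
    (hΩ : IsOpen Ω) (hC2 : HasC2Boundary Ω) : ∃ γ v A, IsSlidingCurve Ω γ v A := by
  obtain ⟨ρ, hρ⟩ := hC2.exists_isDefiningFunctionAt hΩ hψ.mem_frontier
  obtain ⟨v, -, hv⟩ := hρ.exists_norm_lt_one_fderiv_neg
  obtain ⟨c, hc, hdecay⟩ := hρ.exists_comp_le_sub_sq hψ
  obtain ⟨γ, hγ0, hγ, hγ', htan⟩ := exists_isComplexTangent_curve hρ.contDiffAt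
    hρ.fderiv_ne_zero (hρ.isComplexTangent_deriv hψ)
  rw [hρ.apply_eq_zero] at htan
  have hderiv : deriv γ 0 = deriv ψ 0 := hγ.hasDerivAt.deriv
  have hγp : Tendsto γ (𝓝 0) (𝓝 (ψ 0)) := hγ0 ▸ hγ.hasDerivAt.continuousAt
  have hγ'p : Tendsto (deriv γ) (𝓝 0) (𝓝 (deriv ψ 0)) := hderiv ▸ hγ'
  have hmap : Tendsto (fun y : (ℝ × ℝ) × ℂ => (((γ y.1.1, deriv γ y.1.1), y.2), y.1.2))
      ((𝓝 0 ×ˢ 𝓝[>] 0) ×ˢ 𝓝 0) (𝓝 (((ψ 0, deriv ψ 0), 0), 0)) := by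
    have hs : Tendsto (fun y : (ℝ × ℝ) × ℂ => y.1.1) ((𝓝 0 ×ˢ 𝓝[>] 0) ×ˢ 𝓝 0) (𝓝 0) :=
      tendsto_fst.comp tendsto_fst
    have ht : Tendsto (fun y : (ℝ × ℝ) × ℂ => y.1.2) ((𝓝 0 ×ˢ 𝓝[>] 0) ×ˢ 𝓝 0) (𝓝 0) :=
      (tendsto_snd.comp tendsto_fst).mono_right nhdsWithin_le_nhds
    exact (((hγp.comp hs).prodMk_nhds (hγ'p.comp hs)).prodMk_nhds tendsto_snd).prodMk_nhds ht
  obtain ⟨P, hP, Q, hQ, hPQ⟩ := eventually_prod_iff.1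
    (hmap.eventually (hρ.eventually_discThrough_add_smul_mem hψ hv))
  obtain ⟨r, hr, hball⟩ := Metric.eventually_nhds_iff_ball.1 hQ
  refine ⟨γ, v, r⁻¹, by rwa [hderiv], ?_, ?_, ?_⟩
  · rw [hderiv]
    exact deriv_ne_zero_of_eventually_le_sub_sq hψ.differentiable
      (hρ.contDiffAt.differentiableAt two_ne_zero) hc hdecay
  · filter_upwards [hγp.eventually hρ.eventually_mem_iff, htan] with s hmem hs
    rw [hmem, hs.1]
    exact lt_irrefl 0
  · filter_upwards [hP, tendsto_fst.eventually htan, tendsto_snd.eventually self_mem_nhdsWithin]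
      with z hz hs ht
    have hdisc : ∀ σ ∈ ball 0 r, discThrough ψ (γ z.1) (deriv γ z.1) σ + z.2 • v ∈ Ω :=
      fun σ hσ => hPQ hz (hball σ hσ) hs.2 hs.1 ht
    refine ⟨?_, kobayashiRoyden_add_smul_le_of_discThrough_mem hψ.differentiable hr hdisc⟩
    simpa [discThrough_zero] using hdisc 0 (mem_ball_self hr)

end SlidingCurve

lemma eventually_Icc_subset {S : Set ℝ} {x : ℝ} (hS : S ∈ 𝓝 x) :
    ∀ᶠ a in 𝓝 x, Icc x a ⊆ S :=
  (tendsto_const_nhds.Icc tendsto_id).eventually (eventually_smallSets_subset.2 hS)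

lemma tendsto_add_smul_nhdsGT {E : Type*} [NormedAddCommGroup E] [NormedSpace ℝ E] (x v : E) :
    Tendsto (fun t : ℝ => x + t • v) (𝓝[>] 0) (𝓝 x) :=
  ((show Continuous fun t : ℝ => x + t • v by fun_prop).tendsto' 0 x (by simp)).mono_left
    nhdsWithin_le_nhds

namespace IsSlidingCurve

variable {n : ℕ} {Ω : Set (Cn n)} {γ : ℝ → Cn n} {v : Cn n} {A lam ε : ℝ}

lemma eventually_isAlmostGeodesic (h : IsSlidingCurve Ω γ v A)
    (hlen : ∀ᶠ q : ℝ × ℝ in 𝓝 (0, 0), q.1 ≤ q.2 → ∀ u, ENNReal.ofReal (A * (q.2 - q.1)) ≤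
      ENNReal.ofReal lam * kobayashiDist Ω (γ q.1 + u) (γ q.2 + u) + ENNReal.ofReal ε) :
    ∀ᶠ a in 𝓝[>] 0, ∀ᶠ t : ℝ in 𝓝[>] 0, IsAlmostGeodesic Ω lam ε a fun s => γ s + t • v := by
  obtain ⟨K, S, hS, hlip⟩ := h.hasStrictDerivAt.hasStrictFDerivAt.exists_lipschitzOnWith
  obtain ⟨P, hP, Q, hQ, hPQ⟩ := eventually_prod_iff.1 h.eventually_mem_and_speed_le
  rw [nhds_prod_eq] at hlen
  obtain ⟨L, hL, hLlen⟩ := eventually_prod_self_iff'.1 hlen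
  filter_upwards [nhdsWithin_le_nhds (eventually_Icc_subset (inter_mem hS (inter_mem hP hL))),
    self_mem_nhdsWithin] with a hsub (ha : 0 < a)
  filter_upwards [hQ] with t ht
  refine ⟨ha.le, fun s hs => (hPQ (hsub hs).2.1 ht).1, ?_, fun t₁ t₂ h₁ h₁₂ h₂ => ?_⟩
  · have hlip' : LipschitzOnWith K (fun s => γ s + t • v) (uIcc 0 a) := by
      rw [uIcc_of_le ha.le]
      exact fun x hx y hy => by
        simpa only [edist_add_right] using hlip (hsub hx).1 (hsub hy).1
    exact hlip'.absolutelyContinuousOnInterval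
  · have hmem : ∀ s ∈ Icc t₁ t₂, s ∈ Icc 0 a := Icc_subset_Icc h₁ h₂
    calc kobayashiLength Ω (fun s => γ s + t • v) t₁ t₂
        ≤ ∫⁻ _ in Icc t₁ t₂, ENNReal.ofReal A :=
          setLIntegral_mono measurable_const fun s hs => by
            rw [deriv_add_const]
            exact (hPQ (hsub (hmem s hs)).2.1 ht).2
      _ = ENNReal.ofReal (A * (t₂ - t₁)) := by
          rw [setLIntegral_const, Real.volume_Icc, ENNReal.ofReal_mul' (sub_nonneg.2 h₁₂)]
      _ ≤ _ := hLlen _ (hsub (hmem t₁ ⟨le_rfl, h₁₂⟩)).2.2 _ (hsub (hmem t₂ ⟨h₁₂, le_rfl⟩)).2.2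
          h₁₂ _

lemma eventually_mem_frontier (h : IsSlidingCurve Ω γ v A) (hΩ : IsOpen Ω) :
    ∀ᶠ s in 𝓝 0, γ s ∈ frontier Ω := by
  filter_upwards [h.eventually_notMem, h.eventually_mem_and_speed_le.curry] with s hs hmem
  rw [hΩ.frontier_eq]
  exact ⟨mem_closure_of_tendsto (tendsto_add_smul_nhdsGT (γ s) v) (hmem.mono fun t ht => ht.1), hs⟩

/-- Visibility fails because, for small `t`, the arc `γ s + t • v` avoids any given compact subset
of `Ω` while its end points stay near two distinct boundary points. -/
lemma not_hasVisibility (h : IsSlidingCurve Ω γ v A) (hΩ : IsOpen Ω)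
    (hgeo : ∀ᶠ a in 𝓝[>] 0, ∀ᶠ t : ℝ in 𝓝[>] 0, IsAlmostGeodesic Ω lam ε a fun s => γ s + t • v) :
    ¬ HasVisibility Ω lam ε := by
  intro hvis
  have hne : ∀ᶠ a in 𝓝[>] 0, γ a ≠ γ 0 := nhdsGT_le_nhdsNE 0
    (h.hasStrictDerivAt.hasDerivAt.eventually_ne h.deriv_ne_zero)
  have hfrontier : ∀ᶠ a in 𝓝[>] 0, Icc 0 a ⊆ {s | γ s ∈ frontier Ω} :=
    nhdsWithin_le_nhds (eventually_Icc_subset (h.eventually_mem_frontier hΩ))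
  obtain ⟨a, ha, hgeo, hne, hfrontier⟩ :=
    (eventually_mem_nhdsWithin.and (hgeo.and (hne.and hfrontier))).exists
  have h0 : (0 : ℝ) ∈ Icc 0 a := left_mem_Icc.2 (le_of_lt ha)
  have h1 : a ∈ Icc 0 a := right_mem_Icc.2 (le_of_lt ha)
  obtain ⟨U, hU, V, hV, K, hK, hKΩ, hmeet⟩ :=
    hvis _ (hfrontier h0) _ (hfrontier h1) hne.symm
  obtain ⟨δ, hδ, hthick⟩ := hK.exists_thickening_subset_open hΩ hKΩ
  have hUt := (tendsto_add_smul_nhdsGT (γ 0) v).eventually hU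
  have hVt := (tendsto_add_smul_nhdsGT (γ a) v).eventually hV
  have hδt := (tendsto_add_smul_nhdsGT 0 v).eventually (ball_mem_nhds 0 hδ)
  obtain ⟨t, hgeo, htU, htV, htδ⟩ := (hgeo.and (hUt.and (hVt.and hδt))).exists
  obtain ⟨_, ⟨s, hs, rfl⟩, hsK⟩ := hmeet a _ hgeo ⟨hgeo.mapsTo h0, htU⟩ ⟨hgeo.mapsTo h1, htV⟩
  have hmem : γ s ∈ Ω := hthick (mem_thickening_iff.2 ⟨_, hsK, by
    simpa [dist_eq_norm] using htδ⟩)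
  exact (hΩ.frontier_eq.subset (hfrontier hs)).2 hmem

lemma not_hasVisibility_of_pos (h : IsSlidingCurve Ω γ v A) (hΩ : IsOpen Ω) (hε : 0 < ε) :
    ¬ HasVisibility Ω lam ε := by
  refine h.not_hasVisibility hΩ (h.eventually_isAlmostGeodesic ?_)
  have hlim : Tendsto (fun q : ℝ × ℝ => A * (q.2 - q.1)) (𝓝 (0, 0)) (𝓝 0) :=
    (show Continuous fun q : ℝ × ℝ => A * (q.2 - q.1) by fun_prop).tendsto' _ _ (by simp)
  filter_upwards [hlim.eventually_lt_const hε] with q hq _ u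
  exact (ENNReal.ofReal_le_ofReal hq.le).trans le_add_self

lemma exists_mul_sub_le_dist (h : IsSlidingCurve Ω γ v A) :
    ∃ b > 0, ∀ᶠ q : ℝ × ℝ in 𝓝 (0, 0), b * (q.2 - q.1) ≤ dist (γ q.1) (γ q.2) := by
  obtain ⟨C, hC, hbound⟩ := (h.hasStrictDerivAt.isTheta_sub h.deriv_ne_zero).2.exists_pos
  refine ⟨C⁻¹, inv_pos.2 hC, hbound.bound.mono fun q hq => ?_⟩
  rw [inv_mul_le_iff₀ hC, dist_eq_norm]
  refine le_trans ?_ hq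
  rw [norm_sub_rev]
  exact le_abs_self _

lemma eventually_not_hasVisibility_zero (h : IsSlidingCurve Ω γ v A) (hΩ : IsOpen Ω)
    (hbdd : Bornology.IsBounded Ω) : ∀ᶠ lam in atTop, ¬ HasVisibility Ω lam 0 := by
  obtain ⟨m, hm, hdist⟩ := exists_mul_dist_le_kobayashiDist hbdd
  obtain ⟨b, hb, hγ⟩ := h.exists_mul_sub_le_dist
  filter_upwards [eventually_ge_atTop (A / (m * b)), eventually_ge_atTop 0] with lam hlam hlam0
  refine h.not_hasVisibility hΩ (h.eventually_isAlmostGeodesic (hγ.mono fun q hq hle u => ?_))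
  have hA : A ≤ lam * (m * b) := (div_le_iff₀ (by positivity)).1 hlam
  calc ENNReal.ofReal (A * (q.2 - q.1))
      ≤ ENNReal.ofReal (lam * (m * dist (γ q.1 + u) (γ q.2 + u))) := by
        refine ENNReal.ofReal_le_ofReal ?_
        calc A * (q.2 - q.1) ≤ lam * (m * b) * (q.2 - q.1) := by gcongr
          _ = lam * (m * (b * (q.2 - q.1))) := by ring
          _ ≤ lam * (m * dist (γ q.1 + u) (γ q.2 + u)) := by rw [dist_add_right]; gcongr
    _ = ENNReal.ofReal lam * ENNReal.ofReal (m * dist (γ q.1 + u) (γ q.2 + u)) :=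
        ENNReal.ofReal_mul hlam0
    _ ≤ ENNReal.ofReal lam * kobayashiDist Ω (γ q.1 + u) (γ q.2 + u) + ENNReal.ofReal 0 := by
        rw [ENNReal.ofReal_zero, add_zero]
        gcongr
        exact hdist _ _

end IsSlidingCurve

lemma isPseudoconvex_univ {n : ℕ} (hbdd : Bornology.IsBounded (univ : Set (Cn n))) :
    IsPseudoconvex (univ : Set (Cn n)) := by
  refine ⟨fun _ => 0, ⟨continuousOn_const, fun z w _ => by simp [Real.circleAverage_const]⟩,
    fun c => ?_⟩
  refine isCompact_of_isClosed_isBounded ?_ (hbdd.subset (subset_univ _))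
  by_cases hc : 0 ≤ c <;> simp [hc]

theorem theorem1_general {n : ℕ} {Ω : Set (Cn n)} (hopen : IsOpen Ω)
    (hbdd : Bornology.IsBounded Ω) (hC2 : HasC2Boundary Ω)
    (hvis : (∃ lam ε : ℝ, 0 < ε ∧ HasVisibility Ω lam ε) ∨
      ∃ᶠ lam in atTop, HasVisibility Ω lam 0) :
    IsPseudoconvex Ω := by
  rcases eq_or_ne Ω univ with rfl | hne
  · exact isPseudoconvex_univ hbdd
  refine isPseudoconvex_of_le_circleAverage hopen hne hbdd fun z w hzw => ?_
  by_contra! hlt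
  obtain ⟨ψ, hψ⟩ := exists_isInnerTouchingDisc hopen hne hzw hlt
  obtain ⟨γ, v, A, hγ⟩ := hψ.exists_isSlidingCurve hopen hC2
  rcases hvis with ⟨lam, ε, hε, hvis⟩ | hvis
  · exact hγ.not_hasVisibility_of_pos hopen hε hvis
  · exact hvis (hγ.eventually_not_hasVisibility_zero hopen hbdd)

theorem theorem1 {n : ℕ} (Ω : Set (Cn n)) (hopen : IsOpen Ω) (hconn : IsConnected Ω)
    (hbdd : Bornology.IsBounded Ω) (hC2 : HasC2Boundary Ω)
    (hvis : (∃ ε : ℝ, 0 < ε ∧ HasVisibility Ω 1 ε) ∨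
      (∀ lam : ℝ, 1 < lam → HasVisibility Ω lam 0)) :
    IsPseudoconvex Ω :=
  theorem1_general hopen hbdd hC2 <| hvis.imp (fun h => ⟨1, h⟩) fun h =>
    ((eventually_gt_atTop 1).mono h).frequently
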